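/- Let $F$ be a free group of finite rank $k\ge 2$, let $\partial F$ be its hyperbolic boundary (for the word metric of any free basis) and let $\partial^2F=\{(\zeta_1,\zeta_2)\in\partial F\times\partial F:\zeta_1\ne\zeta_2\}$. A geodesic current on $F$ is a positive Borel measure on $\partial^2F$ that is finite on compact sets and invariant under the translation action of $F$. Let $cv(F)$ be the non-projectivized outer space, that is, the set of all minimal free and discrete isometric actions of $F$ on $\mathbb R$-trees, up to $F$-equivariant isometry. For $T\in cv(F)$, identify $\partial F$ with $\partial T$ through an orbit map $F\to T$, $g\mapsto gx_0$. For $x,y\in T$ let $\mathrm{Cyl}_{[x,y]}\subseteq\partial^2F$ be the set of all $(\zeta_1,\zeta_2)$ such that the bi-infinite geodesic of $T$ from $\zeta_1$ to $\zeta_2$ contains the segment $[x,y]$, with the same orientation. The geometric entropy of a geodesic current $\mu$ with respect to $T$ is $$h_T(\mu)=\liminf_{d_T(x,y)\to\infty,\ x,y\in T}\frac{-\log\mu(\mathrm{Cyl}_{[x,y]})}{d_T(x,y)}\in[-\infty,\infty],\qquad \log 0=-\infty .$$ Then for every geodesic current $\mu$ on $F$ and all $T,T'\in cv(F)$, $$h_T(\mu)>0\iff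 h_{T'}(\mu)>0 .$$ Thus whether $\mu$ decays exponentially fast (that is, $h_T(\mu)>0$) does not depend on the choice of $T\in cv(F)$. -/

import Mathlib

open Set Filter Topology MeasureTheory

/-! ### The hyperbolic boundary of a free group -/

section FreeGroupBoundary

variable {F : Type*} [Group F] {k : ℕ}

/-- The word metric on the free group `F` with respect to the free basis `b`. -/
def wordDist (b : FreeGroupBasis (Fin k) F) (g h : F) : ℕ :=
  (b.repr (g⁻¹ * h)).norm

theorem wordDist_self (b : FreeGroupBasis (Fin k) F) (g : F) : wordDist b g g = 0 := by
  simp [wordDist]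

theorem wordDist_comm (b : FreeGroupBasis (Fin k) F) (g h : F) :
    wordDist b g h = wordDist b h g := by
  have h1 : g⁻¹ * h = (h⁻¹ * g)⁻¹ := by group
  rw [wordDist, wordDist, h1, map_inv, FreeGroup.norm_inv_eq]

theorem wordDist_triangle (b : FreeGroupBasis (Fin k) F) (g h l : F) :
    wordDist b g l ≤ wordDist b g h + wordDist b h l := by
  have h1 : g⁻¹ * l = (g⁻¹ * h) * (h⁻¹ * l) := by group
  rw [wordDist, wordDist, wordDist, h1, map_mul]
  exact FreeGroup.norm_mul_le _ _

theorem wordDist_mul_left (b : FreeGroupBasis (Fin k) F) (a g h : F) :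
    wordDist b (a * g) (a * h) = wordDist b g h := by
  have h1 : (a * g)⁻¹ * (a * h) = g⁻¹ * h := by group
  rw [wordDist, wordDist, h1]

/-- Geodesic rays in `F` for the word metric, starting at an arbitrary element of `F`. -/
def GroupRay (b : FreeGroupBasis (Fin k) F) : Type _ :=
  {r : ℕ → F // ∀ m n : ℕ, wordDist b (r m) (r (m + n)) = n}

/-- The topology of pointwise convergence on rays, where `F` is discrete. -/
instance GroupRay.instTopologicalSpace (b : FreeGroupBasis (Fin k) F) :
    TopologicalSpace (GroupRay b) :=
  TopologicalSpace.induced (fun r => r.1) (@Pi.topologicalSpace ℕ (fun _ => F) (fun _ => ⊥))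

/-- Two rays are asymptotic if they stay at bounded distance from each other. -/
instance GroupRay.setoid (b : FreeGroupBasis (Fin k) F) : Setoid (GroupRay b) where
  r r₁ r₂ := ∃ C : ℕ, ∀ n, wordDist b (r₁.1 n) (r₂.1 n) ≤ C
  iseqv :=
    { refl := fun r => ⟨0, fun n => (wordDist_self b (r.1 n)).le⟩
      symm := by
        rintro r₁ r₂ ⟨C, hC⟩
        exact ⟨C, fun n => by rw [wordDist_comm]; exact hC n⟩
      trans := by
        rintro r₁ r₂ r₃ ⟨C, hC⟩ ⟨D, hD⟩
        exact ⟨C + D, fun n =>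
          (wordDist_triangle b _ (r₂.1 n) _).trans (add_le_add (hC n) (hD n))⟩ }

/-- The left translate of a ray. -/
def GroupRay.translate (b : FreeGroupBasis (Fin k) F) (g : F) (r : GroupRay b) : GroupRay b :=
  ⟨fun n => g * r.1 n, fun m n => by rw [wordDist_mul_left]; exact r.2 m n⟩

/-- The hyperbolic boundary `∂F`: asymptotic classes of geodesic rays in `F`. -/
def FreeBoundary (b : FreeGroupBasis (Fin k) F) : Type _ :=
  Quotient (GroupRay.setoid b)

/-- The quotient topology. (The rays from a fixed base point form a clopen set of rays, and each
of these sets induces the same topology on the boundary.) -/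
instance FreeBoundary.instTopologicalSpace (b : FreeGroupBasis (Fin k) F) :
    TopologicalSpace (FreeBoundary b) :=
  inferInstanceAs (TopologicalSpace (Quotient (GroupRay.setoid b)))

/-- The boundary point at which a ray ends. -/
def GroupRay.endpoint (b : FreeGroupBasis (Fin k) F) (r : GroupRay b) : FreeBoundary b :=
  Quotient.mk (GroupRay.setoid b) r

/-- The left translation action of `F` on `∂F`. -/
instance FreeBoundary.instMulAction (b : FreeGroupBasis (Fin k) F) :
    MulAction F (FreeBoundary b) where
  smul g := Quotient.map (GroupRay.translate b g) (by
    rintro r₁ r₂ ⟨C, hC⟩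
    exact ⟨C, fun n => by
      rw [GroupRay.translate, GroupRay.translate, wordDist_mul_left]; exact hC n⟩)
  one_smul := by
    intro x
    induction x using Quotient.inductionOn with
    | h r => exact congrArg (Quotient.mk _) (Subtype.ext (funext fun n => one_mul (r.1 n)))
  mul_smul := by
    intro g h x
    induction x using Quotient.inductionOn with
    | h r => exact congrArg (Quotient.mk _) (Subtype.ext (funext fun n => mul_assoc g h (r.1 n)))

/-- `∂²F`, the space of ordered pairs of distinct boundary points. -/
def DoubleBoundary (b : FreeGroupBasis (Fin k) F) : Type _ :=
  {p : FreeBoundary b × FreeBoundary b // p.1 ≠ p.2}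

instance DoubleBoundary.instTopologicalSpace (b : FreeGroupBasis (Fin k) F) :
    TopologicalSpace (DoubleBoundary b) :=
  inferInstanceAs (TopologicalSpace {p : FreeBoundary b × FreeBoundary b // p.1 ≠ p.2})

/-- The Borel σ-algebra. -/
instance DoubleBoundary.instMeasurableSpace (b : FreeGroupBasis (Fin k) F) :
    MeasurableSpace (DoubleBoundary b) :=
  borel (DoubleBoundary b)

/-- The diagonal action of `F` on `∂²F`. -/
instance DoubleBoundary.instMulAction (b : FreeGroupBasis (Fin k) F) :
    MulAction F (DoubleBoundary b) where
  smul g p := ⟨(g • p.1.1, g • p.1.2), fun h => p.2 (MulAction.injective g h)⟩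
  one_smul p := Subtype.ext (Prod.ext (one_smul F p.1.1) (one_smul F p.1.2))
  mul_smul g h p := Subtype.ext (Prod.ext (mul_smul g h p.1.1) (mul_smul g h p.1.2))

/-- A geodesic current on `F`: an `F`-invariant positive Borel measure on `∂²F` that is finite on
compact sets. -/
structure GeodesicCurrent (b : FreeGroupBasis (Fin k) F) where
  toMeasure : Measure (DoubleBoundary b)
  finite_on_compacts : IsFiniteMeasureOnCompacts toMeasure
  invariant : SMulInvariantMeasure F (DoubleBoundary b) toMeasure

end FreeGroupBoundary

/-! ### Trees in the outer space -/

/-- An `ℝ`-tree: a nonempty geodesic metric space that is `0`-hyperbolic (four-point condition). -/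
structure IsRealTree (T : Type*) [MetricSpace T] : Prop where
  nonempty : Nonempty T
  geodesic : ∀ x y : T, ∃ γ : ℝ → T, γ 0 = x ∧ γ (dist x y) = y ∧
    ∀ s ∈ Icc (0 : ℝ) (dist x y), ∀ t ∈ Icc (0 : ℝ) (dist x y), dist (γ s) (γ t) = |s - t|
  four_point : ∀ x y z w : T,
    dist x y + dist z w ≤ max (dist x z + dist y w) (dist x w + dist y z)

/-- `T`, with its action of `F`, represents a point of the (non-projectivized) outer space
`cv(F)`: `T` is an `ℝ`-tree and the action is isometric, free, discrete and minimal
(there is no nonempty proper `F`-invariant subtree). The geodesic segment between `x` and `y` in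
an `ℝ`-tree is `{z | dist x z + dist z y = dist x y}`. -/
structure IsOuterSpaceTree (F T : Type*) [Group F] [MetricSpace T] [MulAction F T] : Prop where
  isRealTree : IsRealTree T
  isometric : IsIsometricSMul F T
  free : ∀ (g : F) (x : T), g • x = x → g = 1
  discrete : ProperlyDiscontinuousSMul F T
  minimal : ∀ S : Set T, S.Nonempty →
    (∀ x ∈ S, ∀ y ∈ S, ∀ z : T, dist x z + dist z y = dist x y → z ∈ S) →
    (∀ (g : F), ∀ x ∈ S, g • x ∈ S) → S = univ

/-! ### Cylinders and geometric entropy -/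

section Entropy

variable {F : Type*} [Group F] {k : ℕ} {T : Type*} [MetricSpace T] [MulAction F T]

/-- The geodesic ray `ρ : [0, ∞) → T` ends at the point of `∂T` that corresponds to `ζ ∈ ∂F` under
the boundary map of the orbit map `g ↦ g • x₀`: for a geodesic ray `r` in `F` that ends at `ζ`,
the orbit points `r n • x₀` are at finite Hausdorff distance from `ρ`. (Changing the base point
changes Hausdorff distances by a bounded amount only; here it is `ρ 0`.) -/
def EndsAt (b : FreeGroupBasis (Fin k) F) (ρ : ℝ → T) (ζ : FreeBoundary b) : Prop :=
  ∃ r : GroupRay b, GroupRay.endpoint b r = ζ ∧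
    Metric.hausdorffEDist (range fun n : ℕ => r.1 n • ρ 0) (ρ '' Ici 0) ≠ ⊤

/-- The two-sided cylinder `Cyl_{[x,y]}`: the pairs `(ζ₁, ζ₂)` such that the oriented bi-infinite
geodesic in `T` from `ζ₁` to `ζ₂` passes first through `x` and then through `y`. -/
def Cyl (b : FreeGroupBasis (Fin k) F) (x y : T) : Set (DoubleBoundary b) :=
  {p | ∃ γ : ℝ → T, Isometry γ ∧
    EndsAt b (fun t => γ (-t)) p.1.1 ∧ EndsAt b γ p.1.2 ∧
    ∃ s t : ℝ, s ≤ t ∧ γ s = x ∧ γ t = y}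

/-- The geometric entropy of the current `μ` with respect to `T`: the lower limit of
`-log μ(Cyl_{[x,y]}) / d(x,y)` as `d(x,y) → ∞`, in the extended reals, with `log 0 = -∞`. -/
noncomputable def geometricEntropy {b : FreeGroupBasis (Fin k) F} (μ : GeodesicCurrent b)
    (T : Type*) [MetricSpace T] [MulAction F T] : EReal :=
  liminf (fun p : T × T =>
      -(ENNReal.log (μ.toMeasure (Cyl b p.1 p.2))) / ((dist p.1 p.2 : ℝ) : EReal))
    (comap (fun p : T × T => dist p.1 p.2) atTop)

end Entropy

/-! The point is that a cylinder of one tree lies in a cylinder of comparable length of the other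
(`IsOuterSpaceTree.exists_cyl_subset_cyl`). Monotonicity of the measure then transfers exponential
decay, at the cost of a factor in the rate, and the roles of the trees are symmetric.

For the inclusion, minimality makes both actions cocompact, so by Milnor–Schwarz
(`IsOuterSpaceTree.exists_le_displacement`) the orbit maps give a quasi-isometry `f : T' → T`. It
sends a geodesic through `x'`, `y'` to a quasi-geodesic. By the Morse lemma
(`IsQuasiGeodesic.hasBoundedDetour`) and the tripod property, the geodesic of `T` with the same ends
contains `[f x', f y']` with a fixed length cut off at each end, and this shorter segment does not
depend on the geodesic. That geodesic is built by hand, through abscissas measured from the far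
points of the quasi-geodesic. -/

section RealTree

variable {T : Type*} [MetricSpace T]

/-! ### Segments and tripods in real trees. -/

namespace IsRealTree

theorem four_point_or (hT : IsRealTree T) (x y z w : T) :
    dist x y + dist z w ≤ dist x z + dist y w ∨ dist x y + dist z w ≤ dist x w + dist y z :=
  le_max_iff.1 (hT.four_point x y z w)

/-- Every segment contains a point at each intermediate distance from its first end. -/
theorem exists_mem_segment (hT : IsRealTree T) (x y : T) {t : ℝ} (h0 : 0 ≤ t)
    (h1 : t ≤ dist x y) : ∃ z, dist x z = t ∧ dist z y = dist x y - t := by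
  obtain ⟨γ, g0, g1, hγ⟩ := hT.geodesic x y
  refine ⟨γ t, ?_, ?_⟩
  · have := hγ 0 ⟨le_rfl, dist_nonneg⟩ t ⟨h0, h1⟩
    rw [g0, zero_sub, abs_neg, abs_of_nonneg h0] at this
    exact this
  · have := hγ t ⟨h0, h1⟩ (dist x y) ⟨dist_nonneg, le_rfl⟩
    rw [g1, abs_sub_comm, abs_of_nonneg (by linarith)] at this
    exact this

/-- A triangle in a tree is a tripod. -/
theorem mem_segment_or (hT : IsRealTree T) {x y : T} (w : T) {z : T}
    (hz : dist x z + dist z y = dist x y) :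
    dist x z + dist z w = dist x w ∨ dist w z + dist z y = dist w y := by
  have h1 := dist_triangle x z w
  have h2 := dist_triangle w z y
  have h3 := dist_comm z w
  have h4 := dist_comm y w
  have h5 := dist_comm y z
  rcases hT.four_point_or x y z w with h | h
  · right; linarith
  · left; linarith

/-- A discrete path passes close to every point of the segment joining its ends. -/
theorem exists_dist_le_of_path (hT : IsRealTree T) {q : ℕ → T} {N : ℕ} {e : ℝ} (he : 0 ≤ e)
    (hq : ∀ j < N, dist (q j) (q (j + 1)) ≤ e) {c : T}
    (hc : dist (q 0) c + dist c (q N) = dist (q 0) (q N)) : ∃ j ≤ N, dist (q j) c ≤ e := by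
  by_contra! hcon
  -- A step of length at most `e` cannot cross `c` while staying farther than `e` from it, so `c`
  -- never lies on `[q 0, q j]`; at `j = N` this contradicts `hc`.
  have key : ∀ j ≤ N, dist (q 0) (q j) < dist (q 0) c + dist (q j) c := by
    intro j
    induction j with
    | zero =>
      intro hj
      have := hcon 0 hj
      rw [dist_self]
      linarith
    | succ j ih =>
      intro hj
      have i1 := ih (by omega)
      have i2 := hq j (by omega)
      have i3 := hcon j (by omega)
      have i4 := hcon (j + 1) hj
      have i5 := dist_comm (q j) (q (j + 1))
      have i6 := dist_comm c (q j)
      rcases hT.four_point_or (q 0) (q (j + 1)) c (q j) with h | h <;> linarith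
  have := key N le_rfl
  have := dist_comm c (q N)
  linarith

end IsRealTree

/-! ### Quasi-geodesics and the Morse lemma. -/

/-- A (not necessarily continuous) quasi-geodesic line. -/
def IsQuasiGeodesic (L : ℝ) (p : ℝ → T) : Prop :=
  ∀ s t, dist (p s) (p t) ≤ L * |s - t| + L ∧ |s - t| ≤ L * dist (p s) (p t) + L

theorem IsQuasiGeodesic.comp_neg {L : ℝ} {p : ℝ → T} (hp : IsQuasiGeodesic L p) :
    IsQuasiGeodesic L (fun t => p (-t)) := by
  intro s t
  have h := hp (-s) (-t)
  have : |-s - -t| = |s - t| := by rw [← abs_neg]; congr 1; ring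
  rwa [this] at h

/-- Sampling `p` at steps of length at most 1 replaces continuity: consecutive samples are within `L
* 1 + L`. Using `n + 1` steps avoids a division by zero when `s = t`. -/
theorem IsQuasiGeodesic.exists_dist_le (hT : IsRealTree T) {L : ℝ} (hL : 0 ≤ L) {p : ℝ → T}
    (hp : IsQuasiGeodesic L p) {s t : ℝ} (hst : s ≤ t) {c : T}
    (hc : dist (p s) c + dist c (p t) = dist (p s) (p t)) :
    ∃ r ∈ Icc s t, dist (p r) c ≤ 2 * L := by
  obtain ⟨n, hn⟩ := exists_nat_ge (t - s)
  have hN : (0 : ℝ) < (n + 1 : ℕ) := by positivity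
  have hstep : (t - s) / (n + 1 : ℕ) ≤ 1 := by
    rw [div_le_one hN]; push_cast; linarith
  have hstep0 : 0 ≤ (t - s) / (n + 1 : ℕ) := div_nonneg (by linarith) hN.le
  obtain ⟨j, hj, hd⟩ := hT.exists_dist_le_of_path
    (q := fun j : ℕ => p (s + j * ((t - s) / (n + 1 : ℕ)))) (N := n + 1) (e := 2 * L)
    (c := c) (by linarith)
    (by
      intro j _
      refine (hp _ _).1.trans ?_
      have : s + (j : ℝ) * ((t - s) / (n + 1 : ℕ)) - (s + ((j + 1 : ℕ) : ℝ) *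
          ((t - s) / (n + 1 : ℕ))) = -((t - s) / (n + 1 : ℕ)) := by push_cast; ring
      rw [this, abs_neg, abs_of_nonneg hstep0]
      nlinarith)
    (by
      have : s + ((n + 1 : ℕ) : ℝ) * ((t - s) / (n + 1 : ℕ)) = t := by
        field_simp; ring
      simpa only [this, Nat.cast_zero, zero_mul, add_zero] using hc)
  refine ⟨_, ⟨?_, ?_⟩, hd⟩
  · have : 0 ≤ (j : ℝ) * ((t - s) / (n + 1 : ℕ)) := by positivity
    linarith
  · have h1 : (j : ℝ) ≤ (n + 1 : ℕ) := by exact_mod_cast hj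
    have h2 := mul_le_mul_of_nonneg_right h1 hstep0
    rw [mul_div_cancel₀ _ hN.ne'] at h2
    linarith

/-- The points of `p` lie within `C` of the segments joining earlier to later points of `p`. -/
def HasBoundedDetour (C : ℝ) (p : ℝ → T) : Prop :=
  ∀ s r t, s ≤ r → r ≤ t → dist (p s) (p r) + dist (p r) (p t) ≤ dist (p s) (p t) + 2 * C

theorem HasBoundedDetour.comp_neg {C : ℝ} {p : ℝ → T} (hp : HasBoundedDetour C p) :
    HasBoundedDetour C (fun t => p (-t)) := by
  intro s r t hsr hrt
  have h := hp (-t) (-r) (-s) (by linarith) (by linarith)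
  simp only
  rw [dist_comm (p (-s)) (p (-r)), dist_comm (p (-r)) (p (-t)), dist_comm (p (-s)) (p (-t))]
  linarith

/-- The Morse lemma in a real tree. -/
theorem IsQuasiGeodesic.hasBoundedDetour (hT : IsRealTree T) {L : ℝ} (hL : 0 ≤ L) {p : ℝ → T}
    (hp : IsQuasiGeodesic L p) : HasBoundedDetour (L * (L * (4 * L) + L) + 3 * L) p := by
  intro s r t hsr hrt
  have t1 := dist_triangle (p s) (p r) (p t)
  have t2 := dist_triangle (p s) (p t) (p r)
  have t3 := dist_triangle (p r) (p s) (p t)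
  have e1 := dist_comm (p r) (p s)
  have e2 := dist_comm (p r) (p t)
  -- `c` is the centre of the tripod on `p s`, `p r`, `p t`, and the detour is `2 * dist (p r) c`.
  -- The path passes near `c` both before and after time `r`; those two times are close, so `p r` is
  -- near `c` too.
  obtain ⟨c, hc1, hc2⟩ := hT.exists_mem_segment (p r) (p s)
    (t := (dist (p s) (p r) + dist (p r) (p t) - dist (p s) (p t)) / 2)
    (by linarith) (by linarith)
  have e3 := dist_comm c (p s)
  have e4 := dist_comm c (p r)
  have hc3 : dist (p r) c + dist c (p t) = dist (p r) (p t) := by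
    have := dist_triangle (p r) c (p t)
    rcases hT.four_point_or c (p t) (p s) (p r) with h | h <;>
      linarith [dist_comm (p t) (p r), dist_comm (p t) (p s)]
  obtain ⟨j, hj, hjc⟩ := hp.exists_dist_le hT hL hsr (c := c) (by linarith)
  obtain ⟨l, hl, hlc⟩ := hp.exists_dist_le hT hL hrt (c := c) (by linarith)
  have d1 : dist (p j) (p l) ≤ 4 * L := by
    linarith [dist_triangle_right (p j) (p l) c]
  have d2 : |j - l| ≤ L * (4 * L) + L :=
    (hp j l).2.trans (by linarith [mul_le_mul_of_nonneg_left d1 hL])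
  have d3 : |j - r| ≤ |j - l| := by
    rw [abs_of_nonpos (by linarith [hj.2]), abs_of_nonpos (by linarith [hj.2, hl.1])]
    linarith [hl.1]
  have d4 : dist (p j) (p r) ≤ L * (L * (4 * L) + L) + L :=
    (hp j r).1.trans (by linarith [mul_le_mul_of_nonneg_left (d3.trans d2) hL])
  have d5 := dist_triangle_left (p r) c (p j)
  linarith

/-- A point of `[p s₀, p t₀]` far from the ends lies on `[p s, p t]` for `s ≤ s₀`, `t₀ ≤ t`. -/
theorem HasBoundedDetour.mem_segment (hT : IsRealTree T) {C : ℝ} {p : ℝ → T}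
    (hp : HasBoundedDetour C p) {s₀ t₀ : ℝ} (h0 : s₀ ≤ t₀) {u : T}
    (hu : dist (p s₀) u + dist u (p t₀) = dist (p s₀) (p t₀))
    (h1 : C < dist (p s₀) u) (h2 : C < dist u (p t₀)) {s t : ℝ} (hs : s ≤ s₀) (ht : t₀ ≤ t) :
    dist (p s) u + dist u (p t) = dist (p s) (p t) ∧
      dist (p s) u + dist u (p t₀) = dist (p s) (p t₀) := by
  have a1 := hp s s₀ t₀ hs h0
  have a2 := hp s₀ t₀ t h0 ht
  have c1 := dist_comm (p s) u
  have c2 := dist_comm (p s₀) u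
  have c3 := dist_comm (p t₀) u
  have c4 := dist_comm (p t) u
  have c5 := dist_comm (p s₀) (p s)
  have c6 := dist_comm (p t) (p t₀)
  have c7 := dist_comm (p t) (p s)
  have b1 : dist (p s) u + dist u (p t₀) = dist (p s) (p t₀) := by
    -- Otherwise `u` is on `[p s₀, p s]`, and the path through `p s₀` covers `[p s₀, u]` twice, a
    -- detour above `2 * C`.
    rcases hT.mem_segment_or (p s) hu with h | h
    · linarith [dist_triangle (p s) u (p t₀)]
    · exact h
  refine ⟨?_, b1⟩
  rcases hT.mem_segment_or (p t) b1 with h | h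
  · exact h
  · linarith [dist_triangle (p s₀) u (p t)]

/-! ### The geodesic line with the same ends as a quasi-geodesic. -/

/-- The point `z` has abscissa `t` on the oriented line with the same ends as `p`, when the
point `u` has abscissa `0`. -/
def HasAbscissa (p : ℝ → T) (u : T) (t : ℝ) (z : T) : Prop :=
  ∃ N : ℝ, ∀ s ≤ -N, ∀ m ≥ N,
    dist (p s) z = dist (p s) u + t ∧ dist z (p m) = dist u (p m) - t

theorem HasAbscissa.comp_neg {p : ℝ → T} {u : T} {t : ℝ} {z : T} (h : HasAbscissa p u t z) :
    HasAbscissa (fun t => p (-t)) u (-t) z := by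
  obtain ⟨N, hN⟩ := h
  refine ⟨N, fun s hs m hm => ?_⟩
  have := hN (-m) (by linarith) (-s) (by linarith)
  simp only
  have e1 := dist_comm (p (-s)) z
  have e2 := dist_comm (p (-s)) u
  have e3 := dist_comm (p (-m)) z
  have e4 := dist_comm (p (-m)) u
  constructor <;> linarith

/-- The point `u` lies on all segments `[p s, p t]` for `s ≤ s₀` and `t₀ ≤ t`. -/
def IsCentral (p : ℝ → T) (s₀ t₀ : ℝ) (u : T) : Prop :=
  ∀ s ≤ s₀, ∀ t ≥ t₀, dist (p s) u + dist u (p t) = dist (p s) (p t)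

theorem IsCentral.comp_neg {p : ℝ → T} {s₀ t₀ : ℝ} {u : T} (h : IsCentral p s₀ t₀ u) :
    IsCentral (fun t => p (-t)) (-t₀) (-s₀) u := by
  intro s hs t ht
  have := h (-t) (by linarith) (-s) (by linarith)
  simp only
  linarith [dist_comm (p (-s)) u, dist_comm (p (-t)) u, dist_comm (p (-s)) (p (-t))]

/-- For large `R` both points lie on `[p (-R), p R]`, at positions differing by `t - s`. This gives
isometry of the line and, for `t = s`, uniqueness of the point with a given abscissa. -/
theorem HasAbscissa.dist_eq (hT : IsRealTree T) {p : ℝ → T} {s₀ t₀ : ℝ} {u : T}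
    (hu : IsCentral p s₀ t₀ u) {t s : ℝ} {z w : T} (hz : HasAbscissa p u t z)
    (hw : HasAbscissa p u s w) : dist z w = |t - s| := by
  obtain ⟨N, hN⟩ := hz
  obtain ⟨M, hM⟩ := hw
  set R := max (max N M) (max (-s₀) t₀)
  have r1 : N ≤ R := (le_max_left _ _).trans (le_max_left _ _)
  have r2 : M ≤ R := (le_max_right _ _).trans (le_max_left _ _)
  have r3 : -s₀ ≤ R := (le_max_left _ _).trans (le_max_right _ _)
  have r4 : t₀ ≤ R := (le_max_right _ _).trans (le_max_right _ _)
  obtain ⟨n1, n2⟩ := hN (-R) (by linarith) R r1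
  obtain ⟨m1, m2⟩ := hM (-R) (by linarith) R r2
  have c := hu (-R) (by linarith) R r4
  have e1 := dist_comm z (p (-R))
  have e2 := dist_comm w (p (-R))
  refine le_antisymm ?_ ?_
  · rcases hT.four_point_or z w (p (-R)) (p R) with h | h <;>
      linarith [le_abs_self (t - s), neg_abs_le (t - s)]
  · rw [abs_le']
    constructor
    · linarith [dist_triangle (p (-R)) w z, dist_comm w z]
    · linarith [dist_triangle (p (-R)) z w]

theorem IsCentral.exists_hasAbscissa_of_nonneg (hT : IsRealTree T) {L C : ℝ} (hL : 0 < L)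
    {p : ℝ → T} (hq : IsQuasiGeodesic L p) (hp : HasBoundedDetour C p) {s₀ t₀ : ℝ} {u : T}
    (h0 : s₀ ≤ t₀) (hu : IsCentral p s₀ t₀ u) {t : ℝ} (ht : 0 ≤ t) :
    ∃ z, HasAbscissa p u t z := by
  have hC : 0 ≤ C := by
    have := hp 0 0 0 le_rfl le_rfl
    simp only [dist_self] at this
    linarith
  -- Chosen so that `dist u (p n) ≥ t + C`. A later `p m` may leave `[u, p n]` only within its last
  -- `C`, so the point at distance `t` from `u` is the same for all `m ≥ n`.
  set n := max t₀ (s₀ + L * (t + C + dist (p s₀) u) + L) with hn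
  have n1 : t₀ ≤ n := le_max_left _ _
  have n2 : s₀ + L * (t + C + dist (p s₀) u) + L ≤ n := le_max_right _ _
  have hfar : t + C ≤ dist u (p n) := by
    have h1 := (hq n s₀).2
    have h2 := le_abs_self (n - s₀)
    have h3 : L * (t + C + dist (p s₀) u) ≤ L * dist (p n) (p s₀) := by linarith
    have h4 := le_of_mul_le_mul_left h3 hL
    linarith [dist_triangle (p n) u (p s₀), dist_comm (p n) u, dist_comm (p s₀) u]
  obtain ⟨z, hz1, hz2⟩ := hT.exists_mem_segment u (p n) ht (by linarith)
  refine ⟨z, max (-s₀) n, fun s hs m hm => ?_⟩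
  have hs' : s ≤ s₀ := by linarith [le_max_left (-s₀) n]
  have hm' : n ≤ m := (le_max_right _ _).trans hm
  have c1 := hu s hs' n n1
  have c2 := hu s hs' m (by linarith)
  have a1 : dist (p s) z = dist (p s) u + t := by
    linarith [dist_triangle (p s) u z, dist_triangle (p s) z (p n)]
  refine ⟨a1, ?_⟩
  have d := hp s n m (by linarith) hm'
  have e1 := dist_comm (p n) z
  have e2 := dist_comm (p m) z
  have e3 := dist_comm u (p n)
  have e4 := dist_comm (p m) (p n)
  have e5 := dist_triangle u z (p m)
  rcases hT.four_point_or z (p m) u (p n) with h | h <;> linarith [dist_comm z u, dist_comm u (p m)]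

theorem IsCentral.exists_hasAbscissa (hT : IsRealTree T) {L C : ℝ} (hL : 0 < L)
    {p : ℝ → T} (hq : IsQuasiGeodesic L p) (hp : HasBoundedDetour C p) {s₀ t₀ : ℝ} {u : T}
    (h0 : s₀ ≤ t₀) (hu : IsCentral p s₀ t₀ u) (t : ℝ) : ∃ z, HasAbscissa p u t z := by
  rcases le_total 0 t with ht | ht
  · exact hu.exists_hasAbscissa_of_nonneg hT hL hq hp h0 ht
  · obtain ⟨z, hz⟩ := hu.comp_neg.exists_hasAbscissa_of_nonneg hT hL hq.comp_neg hp.comp_neg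
      (by linarith) (neg_nonneg.2 ht)
    exact ⟨z, by simpa only [neg_neg] using hz.comp_neg⟩

/-- A quasi-geodesic line and the geodesic line with the same ends have positive halves at finite
Hausdorff distance. -/
theorem IsCentral.exists_dist_le (hT : IsRealTree T) {L C : ℝ} (hL : 0 ≤ L)
    {p : ℝ → T} (hq : IsQuasiGeodesic L p) (hp : HasBoundedDetour C p) {s₀ t₀ : ℝ} {u : T}
    (h0 : s₀ ≤ t₀) (hu : IsCentral p s₀ t₀ u) {γ : ℝ → T} (hγ : ∀ t, HasAbscissa p u t (γ t)) :
    ∃ D, (∀ t, 0 ≤ t → ∃ τ, 0 ≤ τ ∧ dist (p t) (γ τ) ≤ D) ∧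
      ∀ τ, 0 ≤ τ → ∃ t, 0 ≤ t ∧ dist (p t) (γ τ) ≤ D := by
  have hC : 0 ≤ C := by
    have := hp 0 0 0 le_rfl le_rfl
    simp only [dist_self] at this
    linarith
  -- `p t` and `γ τ` are equally far from `p s`, and `p t` is within `C` of its projection to the
  -- line; hence `2 * C`.
  have far : ∀ t, t₀ ≤ t → dist (p t) (γ (dist u (p t))) ≤ 2 * C := by
    intro t ht
    set τ := dist u (p t) with hτ
    obtain ⟨N, hN⟩ := hγ τ
    set s := min (-N) s₀
    set m := max N t
    have hs : s ≤ s₀ := min_le_right _ _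
    have hm : t ≤ m := le_max_right _ _
    obtain ⟨a1, a2⟩ := hN s (min_le_left _ _) m (le_max_left _ _)
    have c1 := hu s hs t ht
    have c2 := hu s hs m (by linarith)
    have d := hp s t m (by linarith) hm
    have e1 := dist_comm (p t) (p s)
    have e2 := dist_comm (p t) (γ τ)
    have e3 := dist_comm (p s) (γ τ)
    rcases hT.four_point_or (p t) (γ τ) (p s) (p m) with h | h <;> linarith
  -- The middle term pays for moving a time in `[0, t₀]` up to `t₀`, or one in `[s₀, 0]` up to `0`;
  -- the last is the error of `IsQuasiGeodesic.exists_dist_le`.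
  refine ⟨2 * C + (L * (|s₀| + |t₀|) + L) + 2 * L, ?_, ?_⟩
  · intro t ht
    refine ⟨dist u (p (max t t₀)), dist_nonneg, ?_⟩
    have h1 := far (max t t₀) (le_max_right _ _)
    have h2 := (hq t (max t t₀)).1
    have h3 : |t - max t t₀| ≤ |s₀| + |t₀| := by
      rcases le_total t t₀ with h | h
      · rw [max_eq_right h, abs_of_nonpos (by linarith)]
        linarith [le_abs_self t₀, abs_nonneg s₀]
      · rw [max_eq_left h, sub_self, abs_zero]
        positivity
    linarith [mul_le_mul_of_nonneg_left h3 hL, dist_triangle (p t) (p (max t t₀))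
      (γ (dist u (p (max t t₀))))]
  · intro τ hτ
    obtain ⟨N, hN⟩ := hγ τ
    have hN' : ∀ m ≥ max N t₀, dist (p s₀) (γ τ) + dist (γ τ) (p m) = dist (p s₀) (p m) := by
      intro m hm
      obtain ⟨a1, a2⟩ := hN (min (-N) s₀) (min_le_left _ _) m ((le_max_left _ _).trans hm)
      have c2 := hu s₀ le_rfl m ((le_max_right _ _).trans hm)
      have c3 := hu (min (-N) s₀) (min_le_right _ _) m ((le_max_right _ _).trans hm)
      have c4 := dist_triangle (p s₀) (γ τ) (p m)
      have c5 := dist_triangle (p s₀) u (γ τ)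
      have c6 : dist u (γ τ) ≤ τ := by
        have hu0 : HasAbscissa p u 0 u := ⟨0, fun s _ m _ => by simp⟩
        rw [hu0.dist_eq hT hu (hγ τ), zero_sub, abs_neg, abs_of_nonneg hτ]
      linarith
    obtain ⟨r, hr, hrd⟩ := hq.exists_dist_le hT hL (h0.trans (le_max_right N t₀))
      (hN' _ le_rfl)
    refine ⟨max r 0, le_max_right _ _, ?_⟩
    have h2 := (hq (max r 0) r).1
    have h3 : |max r 0 - r| ≤ |s₀| + |t₀| := by
      rcases le_total r 0 with h | h
      · rw [max_eq_right h, abs_of_nonneg (by linarith)]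
        linarith [neg_abs_le s₀, abs_nonneg t₀, hr.1]
      · rw [max_eq_left h, sub_self, abs_zero]
        positivity
    linarith [mul_le_mul_of_nonneg_left h3 hL, dist_triangle (p (max r 0)) (p r) (γ τ)]

end RealTree

/-! ### Cocompactness, Milnor–Schwarz and the quasi-isometry. -/

section Cocompact

variable {F : Type*} [Group F] {T : Type*} [MetricSpace T] [MulAction F T]

/-- Points of a segment are determined by their distance to `x`, so one geodesic fills it. -/
theorem IsRealTree.isCompact_segment (hT : IsRealTree T) (x y : T) :
    IsCompact {z | dist x z + dist z y = dist x y} := by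
  obtain ⟨γ, g0, g1, hγ⟩ := hT.geodesic x y
  have hcont : ContinuousOn γ (Icc 0 (dist x y)) := by
    refine LipschitzOnWith.continuousOn (K := 1) (LipschitzOnWith.of_dist_le_mul ?_)
    intro s hs t ht
    rw [hγ s hs t ht, Real.dist_eq, NNReal.coe_one, one_mul]
  convert isCompact_Icc.image_of_continuousOn hcont using 1
  ext z
  constructor
  · intro hz
    have hz : dist x z + dist z y = dist x y := hz
    have hm : dist x z ∈ Icc (0 : ℝ) (dist x y) := ⟨dist_nonneg, by linarith [dist_nonneg (x := z) (y := y)]⟩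
    refine ⟨dist x z, hm, ?_⟩
    have a1 := hγ 0 ⟨le_rfl, dist_nonneg⟩ _ hm
    have a2 := hγ _ hm _ ⟨dist_nonneg, le_rfl⟩
    rw [g0, zero_sub, abs_neg, abs_of_nonneg dist_nonneg] at a1
    rw [g1, abs_sub_comm, abs_of_nonneg (by linarith [hm.2])] at a2
    rw [← dist_le_zero]
    rcases hT.four_point_or (γ (dist x z)) z x y with h | h <;>
      linarith [dist_comm x z, dist_comm x (γ (dist x z))]
  · rintro ⟨t, ht, rfl⟩
    have a1 := hγ 0 ⟨le_rfl, dist_nonneg⟩ _ ht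
    have a2 := hγ _ ht _ ⟨dist_nonneg, le_rfl⟩
    rw [g0, zero_sub, abs_neg, abs_of_nonneg ht.1] at a1
    rw [g1, abs_sub_comm, abs_of_nonneg (by linarith [ht.2])] at a2
    simp only [mem_ofPred_eq, a1, a2]
    ring

/-- A minimal action of a finitely generated free group on a real tree is cocompact. -/
theorem IsOuterSpaceTree.exists_isCompact {k : ℕ} (b : FreeGroupBasis (Fin k) F)
    (hT : IsOuterSpaceTree F T) (x₀ : T) :
    ∃ K : Set T, IsCompact K ∧ x₀ ∈ K ∧ ∀ z : T, ∃ g : F, ∃ x ∈ K, g • x = z := by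
  have hR := hT.isRealTree
  have := hT.isometric
  set seg : T → T → Set T := fun x y => {z | dist x z + dist z y = dist x y} with hseg
  have seg_smul : ∀ (g : F) {x y z : T}, z ∈ seg x y → g • z ∈ seg (g • x) (g • y) := by
    intro g x y z hz
    simpa only [hseg, mem_ofPred_eq, dist_smul] using hz
  have seg_symm : ∀ {x y z : T}, z ∈ seg x y → z ∈ seg y x := by
    intro x y z hz
    have hz : dist x z + dist z y = dist x y := hz
    change dist y z + dist z x = dist y x
    linarith [dist_comm x z, dist_comm z y, dist_comm x y]
  have seg_or : ∀ {x y z : T} (w : T), z ∈ seg x y → z ∈ seg x w ∨ z ∈ seg w y :=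
    fun w hz => hR.mem_segment_or w hz
  -- The translates of `K` form the image of the Cayley graph, an invariant subtree, hence
  -- everything by minimality. The singleton keeps `x₀` in `K` when `k = 0`.
  set K : Set T := {x₀} ∪ ⋃ i, seg x₀ (b i • x₀)
  have hK : IsCompact K :=
    isCompact_singleton.union (isCompact_iUnion fun i => hR.isCompact_segment _ _)
  have hx₀ : x₀ ∈ K := Or.inl rfl
  refine ⟨K, hK, hx₀, ?_⟩
  set S : Set T := {z | ∃ g : F, ∃ x ∈ K, g • x = z}
  suffices h : S = univ from fun z => (h ▸ mem_univ z : z ∈ S)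
  have gen : ∀ (i : Fin k) (h : F), seg (h • x₀) (h • b i • x₀) ⊆ S := by
    intro i h z hz
    refine ⟨h, h⁻¹ • z, Or.inr (mem_iUnion.2 ⟨i, ?_⟩), smul_inv_smul h z⟩
    simpa only [inv_smul_smul] using seg_smul h⁻¹ hz
  have conn : ∀ (w : FreeGroup (Fin k)) (h : F),
      seg (h • x₀) (h • b.repr.symm w • x₀) ⊆ S := by
    intro w
    induction w using FreeGroup.induction_on with
    | C1 =>
      intro h z hz
      have hz : dist (h • x₀) z + dist z (h • b.repr.symm 1 • x₀) =
        dist (h • x₀) (h • b.repr.symm 1 • x₀) := hz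
      rw [map_one, one_smul, dist_self] at hz
      exact ⟨h, x₀, hx₀, dist_le_zero.1
        (by linarith [dist_nonneg (x := z) (y := h • x₀)])⟩
    | of i => exact gen i
    | inv_of i _ =>
      intro h z hz
      have := gen i (h * (b i)⁻¹) (a := z)
      rw [smul_smul, inv_mul_cancel_right, mul_smul] at this
      have e : b.repr.symm (FreeGroup.of i)⁻¹ = (b i)⁻¹ := map_inv b.repr.symm _
      refine this (seg_symm ?_)
      rw [← e]
      exact hz
    | mul v w hv hw =>
      intro h z hz
      rcases seg_or (h • b.repr.symm v • x₀) hz with hz | hz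
      · exact hv h hz
      · have := hw (h * b.repr.symm v) (a := z)
        simp only [mul_smul] at this
        rw [map_mul, mul_smul] at hz
        exact this hz
  have conn' : ∀ g h : F, seg (g • x₀) (h • x₀) ⊆ S := by
    intro g h
    have := conn (b.repr (g⁻¹ * h)) g
    rwa [MulEquiv.symm_apply_apply, smul_smul, mul_inv_cancel_left] at this
  -- Joining each point to the orbit inside `S` reduces convexity, by tripods, to segments between
  -- orbit points.
  have toBase : ∀ x ∈ S, ∃ g : F, seg x (g • x₀) ⊆ S := by
    rintro _ ⟨g, x, hx, rfl⟩
    refine ⟨g, ?_⟩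
    rcases hx with hx | hx
    · rw [mem_singleton_iff.1 hx]
      exact conn' g g
    · obtain ⟨i, hi⟩ := mem_iUnion.1 hx
      intro z hz
      refine gen i g ?_
      have hz : dist (g • x) z + dist z (g • x₀) = dist (g • x) (g • x₀) := hz
      have hi : dist (g • x₀) (g • x) + dist (g • x) (g • b i • x₀) =
        dist (g • x₀) (g • b i • x₀) := seg_smul g hi
      change dist (g • x₀) z + dist z (g • b i • x₀) = dist (g • x₀) (g • b i • x₀)
      linarith [dist_triangle (g • x₀) z (g • b i • x₀), dist_triangle z (g • x) (g • b i • x₀),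
        dist_comm z (g • x), dist_comm z (g • x₀), dist_comm (g • x) (g • x₀)]
  refine hT.minimal S ⟨x₀, 1, x₀, hx₀, one_smul _ _⟩ ?_ ?_
  · intro x hx y hy z hz
    obtain ⟨g, hg⟩ := toBase x hx
    obtain ⟨h, hh⟩ := toBase y hy
    rcases seg_or (g • x₀) hz with hz | hz
    · exact hg hz
    rcases seg_or (h • x₀) hz with hz | hz
    · exact conn' g h hz
    · exact hh (seg_symm hz)
  · rintro g _ ⟨h, x, hx, rfl⟩
    exact ⟨g * h, x, hx, mul_smul g h x⟩

/-- Neighbourhoods of `K` need not be compact here. Instead, infinitely many bad elements give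
points `g n • y n` approaching `K`; a convergent subsequence with its limit is a compact set met by
infinitely many translates of `K`. -/
theorem exists_finite_near_translates [ProperlyDiscontinuousSMul F T] {K : Set T}
    (hK : IsCompact K) :
    ∃ ε > 0, {g : F | ∃ x ∈ K, ∃ y ∈ K, dist x (g • y) ≤ ε}.Finite := by
  by_contra! hcon
  have hinf : ∀ n : ℕ, {g : F | ∃ x ∈ K, ∃ y ∈ K, dist x (g • y) ≤ 1 / ((n : ℝ) + 1)}.Infinite :=
    fun n => hcon _ (by positivity)
  obtain ⟨g, hg, hinj⟩ : ∃ g : ℕ → F,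
      (∀ n, ∃ x ∈ K, ∃ y ∈ K, dist x (g n • y) ≤ 1 / ((n : ℝ) + 1)) ∧ Function.Injective g := by
    obtain ⟨f, hf, hlt⟩ := exists_seq_of_forall_finset_exists
      (fun p : ℕ × F => ∃ x ∈ K, ∃ y ∈ K, dist x (p.2 • y) ≤ 1 / ((p.1 : ℝ) + 1))
      (fun p q => p.1 < q.1 ∧ p.2 ≠ q.2) (fun s _ => by
        classical
        obtain ⟨h, hh, hs⟩ := (hinf (s.sup Prod.fst + 1)).exists_notMem_finset (s.image Prod.snd)
        exact ⟨(_, h), hh, fun x hx => ⟨Nat.lt_succ_of_le (Finset.le_sup (f := Prod.fst) hx),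
          fun e => hs (Finset.mem_image.2 ⟨x, hx, e⟩)⟩⟩)
    have hmono : StrictMono fun n => (f n).1 := fun m n h => (hlt m n h).1
    refine ⟨fun n => (f n).2, fun n => ?_, fun m n e => ?_⟩
    · obtain ⟨x, hx, y, hy, h⟩ := hf n
      exact ⟨x, hx, y, hy, h.trans (Nat.one_div_le_one_div (hmono.id_le n))⟩
    · by_contra hne
      rcases lt_or_gt_of_ne hne with h | h
      · exact (hlt m n h).2 e
      · exact (hlt n m h).2 e.symm
  choose x hx y hy hxy using hg
  obtain ⟨a, ha, φ, hφ, hlim⟩ := hK.tendsto_subseq hx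
  have hlim' : Tendsto (fun n => g (φ n) • y (φ n)) atTop (𝓝 a) := by
    refine (tendsto_iff_of_dist ?_).1 hlim
    refine squeeze_zero (fun _ => dist_nonneg) (fun n => hxy (φ n)) ?_
    exact tendsto_one_div_add_atTop_nhds_zero_nat.comp hφ.tendsto_atTop
  have hL := hlim'.isCompact_insert_range
  have hfin := ProperlyDiscontinuousSMul.finite_disjoint_inter_image (Γ := F) hK hL
  refine infinite_of_injective_forall_mem (hinj.comp hφ.injective) (fun n => ?_) hfin
  exact ⟨g (φ n) • y (φ n), ⟨y (φ n), hy _, rfl⟩, Or.inr ⟨n, rfl⟩⟩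

/-- The Milnor–Schwarz lemma: a subadditive function on a group is controlled by the displacement
of an orbit of a cocompact action. -/
theorem IsOuterSpaceTree.exists_le_displacement {k : ℕ} (b : FreeGroupBasis (Fin k) F)
    (hT : IsOuterSpaceTree F T) (x₀ : T) (l : F → ℝ) (hl : ∀ g h, l (g * h) ≤ l g + l h) :
    ∃ L, 0 ≤ L ∧ ∀ g, l g ≤ L * dist x₀ (g • x₀) + L := by
  have hR := hT.isRealTree
  have := hT.isometric
  have := hT.discrete
  obtain ⟨K, hK, hx₀, hcov⟩ := hT.exists_isCompact b x₀
  obtain ⟨ε, hε, hfin⟩ := exists_finite_near_translates (F := F) hK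
  obtain ⟨M, hM⟩ := (hfin.image l).bddAbove
  have hM' : ∀ g : F, ∀ x ∈ K, ∀ y ∈ K, dist x (g • y) ≤ ε → l g ≤ max M 0 :=
    fun g x hx y hy h => (hM ⟨g, ⟨x, hx, y, hy, h⟩, rfl⟩).trans (le_max_left _ _)
  -- Cut `[x, g • y]` at distance `ε` from `x`, at a point `f • w` with `w ∈ K`: `f` belongs to the
  -- finite set, and `f⁻¹ * g` has length `ε` less to cover.
  have key : ∀ n : ℕ, ∀ g : F, ∀ x ∈ K, ∀ y ∈ K, dist x (g • y) ≤ n * ε →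
      l g ≤ (n + 1) * max M 0 := by
    intro n
    induction n with
    | zero =>
      intro g x hx y hy h
      rw [Nat.cast_zero, zero_mul] at h
      simpa using hM' g x hx y hy (h.trans hε.le)
    | succ n ih =>
      intro g x hx y hy h
      push_cast at h
      rcases le_total (dist x (g • y)) ε with h1 | h1
      · refine (hM' g x hx y hy h1).trans ?_
        have : 0 ≤ max M 0 := le_max_right _ _
        push_cast
        nlinarith
      · obtain ⟨z, hz1, hz2⟩ := hR.exists_mem_segment x (g • y) hε.le h1
        obtain ⟨f, w, hw, rfl⟩ := hcov z
        have a1 := hM' f x hx w hw hz1.le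
        have a2 := ih (f⁻¹ * g) w hw y hy (by
          have : dist w ((f⁻¹ * g) • y) = dist (f • w) (g • y) := by
            rw [mul_smul, ← dist_smul f, smul_inv_smul]
          rw [this, hz2]; linarith)
        have a3 := hl f (f⁻¹ * g)
        rw [mul_inv_cancel_left] at a3
        push_cast
        linarith
  refine ⟨max M 0 / ε + 2 * max M 0, by positivity, fun g => ?_⟩
  have h0 : (0 : ℝ) ≤ max M 0 := le_max_right _ _
  have h1 := key ⌈dist x₀ (g • x₀) / ε⌉₊ g x₀ hx₀ x₀ hx₀ (by
    rw [← div_le_iff₀ hε]; exact Nat.le_ceil _)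
  have h2 := Nat.ceil_lt_add_one (div_nonneg (dist_nonneg (x := x₀) (y := g • x₀)) hε.le)
  have h3 := mul_le_mul_of_nonneg_right h2.le h0
  have h4 : dist x₀ (g • x₀) / ε * max M 0 = max M 0 / ε * dist x₀ (g • x₀) := by ring
  have h5 : 0 ≤ max M 0 * dist x₀ (g • x₀) := by positivity
  have h6 : 0 ≤ max M 0 / ε := by positivity
  nlinarith

variable {T' : Type*} [MetricSpace T'] [MulAction F T']

/-- The coarse comparison of two trees of the outer space through their orbit maps. -/
theorem IsOuterSpaceTree.exists_quasiIsometry {k : ℕ} (b : FreeGroupBasis (Fin k) F)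
    (hT : IsOuterSpaceTree F T) (hT' : IsOuterSpaceTree F T') (x₀ : T) (x₀' : T') :
    ∃ (f : T' → T) (L : ℝ), 0 < L ∧
      (∀ z w, dist (f z) (f w) ≤ L * dist z w + L ∧ dist z w ≤ L * dist (f z) (f w) + L) ∧
      ∀ z (g : F), dist (f z) (g • x₀) ≤ L * dist z (g • x₀') + L := by
  have := hT.isometric
  have := hT'.isometric
  have shift : ∀ g h : F, dist x₀ ((g⁻¹ * h) • x₀) = dist (g • x₀) (h • x₀) := fun g h => by
    rw [mul_smul, ← dist_smul g, smul_inv_smul]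
  have shift' : ∀ g h : F, dist x₀' ((g⁻¹ * h) • x₀') = dist (g • x₀') (h • x₀') := fun g h => by
    rw [mul_smul, ← dist_smul g, smul_inv_smul]
  obtain ⟨A, hA0, hA⟩ := hT'.exists_le_displacement b x₀' (fun g => dist x₀ (g • x₀))
    (fun g h => by
      have := dist_triangle x₀ (g • x₀) ((g * h) • x₀)
      rwa [mul_smul, dist_smul, ← mul_smul] at this)
  obtain ⟨B, hB0, hB⟩ := hT.exists_le_displacement b x₀ (fun g => dist x₀' (g • x₀'))
    (fun g h => by
      have := dist_triangle x₀' (g • x₀') ((g * h) • x₀')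
      rwa [mul_smul, dist_smul, ← mul_smul] at this)
  have hA' : ∀ g h : F, dist (g • x₀) (h • x₀) ≤ A * dist (g • x₀') (h • x₀') + A :=
    fun g h => by rw [← shift, ← shift']; exact hA _
  have hB' : ∀ g h : F, dist (g • x₀') (h • x₀') ≤ B * dist (g • x₀) (h • x₀) + B :=
    fun g h => by rw [← shift, ← shift']; exact hB _
  obtain ⟨K, hK, hx, hcov⟩ := hT'.exists_isCompact b x₀'
  have hD : ∀ z : T', ∃ g : F, dist z (g • x₀') ≤ Metric.diam K := by
    intro z
    obtain ⟨g, x, hxK, rfl⟩ := hcov z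
    exact ⟨g, by rw [dist_smul]; exact Metric.dist_le_diam_of_mem hK.isBounded hxK hx⟩
  set D := Metric.diam K
  have hD0 : 0 ≤ D := Metric.diam_nonneg
  -- `σ z` labels an orbit point within `D` of `z`; the map is `z ↦ σ z • x₀`.
  choose σ hσ using hD
  have hAD : 0 ≤ A * D := by positivity
  refine ⟨fun z => σ z • x₀, A + 2 * (A * D) + B + 2 * D + 1, by positivity, fun z w => ⟨?_, ?_⟩,
    fun z g => ?_⟩
  · have h1 := hA' (σ z) (σ w)
    have h2 : dist (σ z • x₀') (σ w • x₀') ≤ dist z w + 2 * D := by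
      linarith [dist_triangle4 (σ z • x₀') z w (σ w • x₀'), dist_comm z (σ z • x₀'), hσ z, hσ w]
    have h3 := mul_le_mul_of_nonneg_left h2 hA0
    have h4 : 0 ≤ (2 * (A * D) + B + 2 * D + 1) * dist z w := by positivity
    linarith
  · have h1 := hB' (σ z) (σ w)
    have h2 : dist z w ≤ dist (σ z • x₀') (σ w • x₀') + 2 * D := by
      linarith [dist_triangle4 z (σ z • x₀') (σ w • x₀') w, dist_comm w (σ w • x₀'), hσ z, hσ w]
    have h4 : 0 ≤ (A + 2 * (A * D) + 2 * D + 1) * dist (σ z • x₀) (σ w • x₀) := by positivity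
    linarith
  · have h1 := hA' (σ z) g
    have h2 : dist (σ z • x₀') (g • x₀') ≤ dist z (g • x₀') + D := by
      linarith [dist_triangle_left (σ z • x₀') (g • x₀') z, hσ z]
    have h3 := mul_le_mul_of_nonneg_left h2 hA0
    have h4 : 0 ≤ (2 * (A * D) + B + 2 * D + 1) * dist z (g • x₀') := by positivity
    linarith

end Cocompact

/-! ### Inclusion of cylinders and comparison of entropies. -/

section EntropyComparison

variable {F : Type*} [Group F] {k : ℕ}
variable {T : Type*} [MetricSpace T] [MulAction F T]
variable {T' : Type*} [MetricSpace T'] [MulAction F T']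

/-- The same ray `r` of `F` serves both trees: `r n • ρ 0`, `r n • x₀`, `f (ρ' t)` and `ρ τ` are
successively at bounded distance when `ρ' t` is near `r n • ρ' 0`. `E` adds up these errors. -/
theorem EndsAt.transfer {b : FreeGroupBasis (Fin k) F} [IsIsometricSMul F T]
    [IsIsometricSMul F T'] {x₀ : T} {x₀' : T'} {f : T' → T} {L : ℝ} (hL : 0 ≤ L)
    (hf : ∀ z (g : F), dist (f z) (g • x₀) ≤ L * dist z (g • x₀') + L)
    {ρ' : ℝ → T'} {ρ : ℝ → T} {D : ℝ}
    (h1 : ∀ t, 0 ≤ t → ∃ τ, 0 ≤ τ ∧ dist (f (ρ' t)) (ρ τ) ≤ D)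
    (h2 : ∀ τ, 0 ≤ τ → ∃ t, 0 ≤ t ∧ dist (f (ρ' t)) (ρ τ) ≤ D)
    {ζ : FreeBoundary b} (h : EndsAt b ρ' ζ) : EndsAt b ρ ζ := by
  obtain ⟨r, hr, hH⟩ := h
  refine ⟨r, hr, ?_⟩
  obtain ⟨C, hC⟩ : ∃ C : NNReal, Metric.hausdorffEDist (range fun n : ℕ => r.1 n • ρ' 0)
      (ρ' '' Ici 0) < C := by
    obtain ⟨C, hC⟩ := ENNReal.lt_iff_exists_nnreal_btwn.1 (lt_top_iff_ne_top.2 hH)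
    exact ⟨C, hC.1⟩
  set E := L * (C + dist x₀' (ρ' 0)) + L + D + dist (ρ 0) x₀ with hE
  have near : ∀ n t, dist (r.1 n • ρ' 0) (ρ' t) ≤ C →
      dist (f (ρ' t)) (r.1 n • ρ 0) ≤ E - D := by
    intro n t ht
    have a1 := hf (ρ' t) (r.1 n)
    have a2 : dist (ρ' t) (r.1 n • x₀') ≤ C + dist x₀' (ρ' 0) := by
      have := dist_triangle_left (ρ' t) (r.1 n • x₀') (r.1 n • ρ' 0)
      rw [dist_smul, dist_comm (ρ' 0)] at this
      linarith
    have a3 := dist_triangle_right (f (ρ' t)) (r.1 n • ρ 0) (r.1 n • x₀)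
    rw [dist_smul] at a3
    linarith [mul_le_mul_of_nonneg_left a2 hL]
  refine ne_top_of_le_ne_top (ENNReal.ofReal_ne_top (r := E))
    (Metric.hausdorffEDist_le_of_mem_edist ?_ ?_)
  · rintro _ ⟨n, rfl⟩
    obtain ⟨_, ⟨t, ht, rfl⟩, hd⟩ := Metric.exists_edist_lt_of_hausdorffEDist_lt
      (mem_range_self n) hC
    obtain ⟨τ, hτ, hd'⟩ := h1 t ht
    rw [edist_nndist, ENNReal.coe_lt_coe, ← NNReal.coe_lt_coe, coe_nndist] at hd
    refine ⟨ρ τ, ⟨τ, hτ, rfl⟩, ?_⟩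
    rw [edist_dist]
    refine ENNReal.ofReal_le_ofReal ?_
    have := near n t hd.le
    linarith [dist_triangle_left (r.1 n • ρ 0) (ρ τ) (f (ρ' t))]
  · rintro _ ⟨τ, hτ, rfl⟩
    obtain ⟨t, ht, hd'⟩ := h2 τ hτ
    obtain ⟨_, ⟨n, rfl⟩, hd⟩ := Metric.exists_edist_lt_of_hausdorffEDist_lt
      (mem_image_of_mem ρ' (show t ∈ Ici (0 : ℝ) from ht))
      (by rwa [Metric.hausdorffEDist_comm])
    rw [edist_nndist, ENNReal.coe_lt_coe, ← NNReal.coe_lt_coe, coe_nndist] at hd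
    refine ⟨_, mem_range_self n, ?_⟩
    rw [edist_dist]
    refine ENNReal.ofReal_le_ofReal ?_
    have := near n t (by rw [dist_comm]; exact hd.le)
    linarith [dist_triangle_left (ρ τ) (r.1 n • ρ 0) (f (ρ' t))]

/-- A cylinder in one tree is contained in a cylinder of comparable length in another tree. -/
theorem IsOuterSpaceTree.exists_cyl_subset_cyl (b : FreeGroupBasis (Fin k) F)
    (hT : IsOuterSpaceTree F T) (hT' : IsOuterSpaceTree F T') :
    ∃ A > 0, ∀ x' y' : T', A < dist x' y' →
      ∃ x y : T, dist x' y' ≤ A * dist x y + A ∧ Cyl b x' y' ⊆ Cyl b x y := by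
  have hR := hT.isRealTree
  have := hT.isometric
  have := hT'.isometric
  obtain ⟨x₀⟩ := hR.nonempty
  obtain ⟨x₀'⟩ := hT'.isRealTree.nonempty
  obtain ⟨f, L, hL, hqi, hf⟩ := hT.exists_quasiIsometry b hT' x₀ x₀'
  set C := L * (L * (4 * L) + L) + 3 * L with hC
  have hC0 : 0 < C := by positivity
  -- Beyond this length `[f x', f y']` is longer than `2 * (C + 1)`. Cutting `C + 1` off each end
  -- leaves `[u, v]`, with the strict margin over `C` needed by `HasBoundedDetour.mem_segment`.
  refine ⟨L * (2 * (C + 1)) + L, by positivity, fun x' y' hxy => ?_⟩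
  have hd : 2 * (C + 1) < dist (f x') (f y') := by
    have := (hqi x' y').2
    exact lt_of_mul_lt_mul_left (by linarith) hL.le
  obtain ⟨u, hu1, hu2⟩ := hR.exists_mem_segment (f x') (f y') (t := C + 1) (by linarith)
    (by linarith)
  obtain ⟨v, hv1, hv2⟩ := hR.exists_mem_segment u (f y')
    (t := dist (f x') (f y') - 2 * (C + 1)) (by linarith) (by linarith)
  refine ⟨u, v, ?_, ?_⟩
  · rw [hv1]
    have h1 := (hqi x' y').2
    have h2 : 0 ≤ L * (2 * (C + 1)) * (dist (f x') (f y') - 2 * (C + 1)) :=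
      mul_nonneg (by positivity) (by linarith)
    linarith
  rintro ⟨⟨ζ₁, ζ₂⟩, hne⟩ ⟨γ', hγ', he₁, he₂, s₀, t₀, h0, rfl, rfl⟩
  set p : ℝ → T := fun t => f (γ' t) with hp
  have hq : IsQuasiGeodesic L p := by
    intro s t
    have := hqi (γ' s) (γ' t)
    rwa [hγ'.dist_eq, Real.dist_eq] at this
  have hb : HasBoundedDetour C p := hq.hasBoundedDetour hR hL.le
  have hu : ∀ s ≤ s₀, ∀ t ≥ t₀, _ := fun s hs t ht =>
    hb.mem_segment hR h0 (u := u) (by simp only [hp]; linarith) (by simp only [hp]; linarith)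
      (by simp only [hp]; linarith) hs ht
  have hv0 : dist (p s₀) v + dist v (p t₀) = dist (p s₀) (p t₀) := by
    simp only [hp]
    linarith [dist_triangle (f (γ' s₀)) v (f (γ' t₀)), dist_triangle (f (γ' s₀)) u v]
  have hv : ∀ s ≤ s₀, ∀ t ≥ t₀, _ := fun s hs t ht =>
    hb.mem_segment hR h0 hv0 (by simp only [hp] at hv0 ⊢; linarith)
      (by simp only [hp]; linarith) hs ht
  have huc : IsCentral p s₀ t₀ u := fun s hs t ht => (hu s hs t ht).1
  choose γ hγ using huc.exists_hasAbscissa hR hL hq hb h0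
  have hu0 : HasAbscissa p u 0 u := ⟨0, fun s _ m _ => by simp⟩
  have hvd : HasAbscissa p u (dist u v) v := by
    refine ⟨max (-s₀) t₀, fun s hs m hm => ?_⟩
    have hs' : s ≤ s₀ := by linarith [le_max_left (-s₀) t₀]
    have hm' : t₀ ≤ m := (le_max_right _ _).trans hm
    obtain ⟨a1, a2⟩ := hu s hs' m hm'
    obtain ⟨a3, a4⟩ := hv s hs' m hm'
    simp only [hp] at a1 a2 a3 a4 ⊢
    constructor <;> linarith
  refine ⟨γ, Isometry.of_dist_eq fun s t => ?_, ?_, ?_, 0, dist u v, dist_nonneg, ?_, ?_⟩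
  · rw [(hγ s).dist_eq hR huc (hγ t), Real.dist_eq]
  -- The backward half is the forward half of the reversed line.
  · obtain ⟨D, hD1, hD2⟩ := huc.comp_neg.exists_dist_le hR hL.le hq.comp_neg hb.comp_neg
      (by linarith) (γ := fun t => γ (-t))
      (fun t => by simpa only [neg_neg] using (hγ (-t)).comp_neg)
    exact he₁.transfer hL.le hf hD1 hD2
  · obtain ⟨D, hD1, hD2⟩ := huc.exists_dist_le hR hL.le hq hb h0 hγ
    exact he₂.transfer hL.le hf hD1 hD2
  · rw [← dist_le_zero, (hγ 0).dist_eq hR huc hu0, sub_self, abs_zero]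
  · rw [← dist_le_zero, (hγ _).dist_eq hR huc hvd, sub_self, abs_zero]

/-- A uniform bound `μ(Cyl) ≤ exp (-c * d)` on long segments passes to smaller cylinders. Null
cylinders satisfy it, their `-log` being `⊤`. -/
theorem geometricEntropy_pos_iff {b : FreeGroupBasis (Fin k) F} (μ : GeodesicCurrent b) :
    0 < geometricEntropy μ T ↔ ∃ c > 0, ∃ R > 0, ∀ x y : T, R ≤ dist x y →
      ((c * dist x y : ℝ) : EReal) ≤ -ENNReal.log (μ.toMeasure (Cyl b x y)) := by
  have hdiv : ∀ (c : ℝ) (x y : T), 0 < dist x y →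
      ((c : EReal) ≤ -(ENNReal.log (μ.toMeasure (Cyl b x y))) / ((dist x y : ℝ) : EReal) ↔
        ((c * dist x y : ℝ) : EReal) ≤ -ENNReal.log (μ.toMeasure (Cyl b x y))) := by
    intro c x y h
    rw [EReal.le_div_iff_mul_le (by exact_mod_cast h) (EReal.coe_ne_top _), EReal.coe_mul]
  constructor
  · intro h
    obtain ⟨c, hc0, hc⟩ := EReal.lt_iff_exists_real_btwn.1 h
    have hev := eventually_lt_of_lt_liminf hc
    rw [eventually_comap] at hev
    obtain ⟨R, hR⟩ := eventually_atTop.1 hev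
    refine ⟨c, by exact_mod_cast hc0, max R 1, by positivity, fun x y hxy => ?_⟩
    exact (hdiv c x y (by linarith [le_max_right R 1])).1
      (hR _ ((le_max_left _ _).trans hxy) (x, y) rfl).le
  · rintro ⟨c, hc, R, hR, h⟩
    refine lt_of_lt_of_le (b := (c : EReal)) (by exact_mod_cast hc) (le_liminf_of_le ?_ ?_)
    · isBoundedDefault
    · rw [eventually_comap]
      filter_upwards [eventually_ge_atTop R] with d hd
      rintro ⟨x, y⟩ rfl
      exact (hdiv c x y (hR.trans_le hd)).2 (h x y hd)

theorem IsOuterSpaceTree.geometricEntropy_pos {b : FreeGroupBasis (Fin k) F}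
    (hT : IsOuterSpaceTree F T) (hT' : IsOuterSpaceTree F T') (μ : GeodesicCurrent b)
    (h : 0 < geometricEntropy μ T) : 0 < geometricEntropy μ T' := by
  rw [geometricEntropy_pos_iff] at h ⊢
  obtain ⟨c, hc, R, hR, h⟩ := h
  obtain ⟨A, hA, hcyl⟩ := hT.exists_cyl_subset_cyl b hT'
  -- Write `d'` and `d` for the lengths in `T'` and `T`. From `d' ≤ A * d + A`, the bound `d' ≥ 2 *
  -- A` gives `d' ≤ 2 * A * d`, and the extra `A * R` ensures `d ≥ R`.
  refine ⟨c / (2 * A), by positivity, 2 * A + A * R, by positivity, fun x' y' hd => ?_⟩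
  have hAR : 0 < A * R := by positivity
  obtain ⟨x, y, hxy, hsub⟩ := hcyl x' y' (by linarith)
  have h1 : R ≤ dist x y := le_of_mul_le_mul_left (by linarith) hA
  have h2 : c / (2 * A) * dist x' y' ≤ c * dist x y := by
    rw [div_mul_eq_mul_div, div_le_iff₀ (by positivity), mul_assoc]
    exact mul_le_mul_of_nonneg_left (by linarith) hc.le
  refine (EReal.coe_le_coe_iff.2 h2).trans ((h x y h1).trans ?_)
  exact EReal.neg_le_neg_iff.2 (ENNReal.log_monotone (measure_mono hsub))

end EntropyComparison

theorem mainTheorem12 {F : Type*} [Group F] {k : ℕ} (hk : 2 ≤ k)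
    (b : FreeGroupBasis (Fin k) F) (μ : GeodesicCurrent b)
    (T : Type*) [MetricSpace T] [MulAction F T] (hT : IsOuterSpaceTree F T)
    (T' : Type*) [MetricSpace T'] [MulAction F T'] (hT' : IsOuterSpaceTree F T') :
    0 < geometricEntropy μ T ↔ 0 < geometricEntropy μ T' :=
  ⟨hT.geometricEntropy_pos hT' μ, hT'.geometricEntropy_pos hT μ⟩
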